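/- A Bratteli diagram $B=(V,E)$ consists of finite sets of vertices $V_0,V_1,\dots$ with $|V_0|=1$, finite sets of edges $E_1,E_2,\dots$, and surjective source and range maps $s:E_n\to V_{n-1}$, $r:E_n\to V_n$ ($n\ge 1$). It is simple if for every $n$ there is $m>n$ such that every vertex of $V_n$ is joined to every vertex of $V_m$ by a path. Let $X_B$ be the space of infinite paths $x=(x_1,x_2,\dots)$, $x_i\in E_i$, $r(x_i)=s(x_{i+1})$, with the topology generated by cylinder sets, and let $v_n(x)\in V_n$ be the vertex of level $n$ on $x$. An order $\omega$ on $B$ is a choice of a linear order on every set $r^{-1}(v)$, $v\in V_n$, $n\geq 1$. A finite or infinite path is maximal (minimal) if each of its edges $e$ is maximal (minimal) in $r^{-1}(r(e))$; $X_{\max}(\omega)$ and $X_{\min}(\omega)$ are the sets of maximal and minimal infinite paths. The Vershik map sends $x\in X_B\setminus X_{\max}(\omega)$, whose first non-maximal edge is $x_k$, to the path $(y_1,\dots,y_{k-1},\overline{x_k},x_{k+1},x_{k+2},\dots)$, where $\overline{x_k}$ is the successor of $x_k$ in $r^{-1}(r(x_k))$ and $(y_1,\dots,y_{k-1})$ is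 the minimal path from $V_0$ to $s(\overline{x_k})$. The order $\omega$ is perfect if the Vershik map extends to a homeomorphism of $X_B$. For $v\in V_N$ and $n<N$ let $w(v,n,N)$ be the word over $V_n$ formed by the sources of all paths from $V_n$ to $v$, in increasing lexicographic order (the last edges are compared first), and let $\mathcal L(B,\omega,n)$ be the set of all contiguous subwords of the words $w(v,n,N)$, $v\in V_N$, $N>n$. Let $\widetilde V_n$ and $\overline V_n$ be the sets of vertices in $V_n$ through which a maximal, respectively minimal, infinite path passes. For $\widetilde v\in\widetilde V_n$ put $\sigma_n(\widetilde v)=\{\overline v\in\overline V_n:\widetilde v\,\overline v\in\mathcal L(B,\omega,n)\}$, and for $\overline v\in\overline V_n$ put $\sigma_n^{-1}(\overline v)=\{\widetilde v\in\widetilde V_n:\overline v\in\sigma_n(\widetilde v)\}$. The class $\mathcal P_B^*$ consists of the perfect orders $\omega$ for which there are levels $0=\ell_0<\ell_1<\cdots$ such that 1. for each $k$, every maximal (minimal) path from $V_{\ell_k}$ to $V_{\ell_{k+1}}$ has its source in $\widetilde V_{\ell_k}$ (in $\overline V_{\ell_k}$); 2. for every $M\in X_{\max}(\omega)$, the set $\sigma_{\ell_k}(v_{\ell_k}(M))$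 has exactly one element for all sufficiently large $k$, and for every $m\in X_{\min}(\omega)$, the set $\sigma_{\ell_k}^{-1}(v_{\ell_k}(m))$ has exactly one element for all sufficiently large $k$. The dimension group $G$ of $B$ is the direct limit of the groups $\mathbb Z^{V_n}$ along the incidence matrices $F_n$, whose $(v,w)$ entry ($v\in V_{n+1}$, $w\in V_n$) is the number of edges from $w$ to $v$. Its positive cone $G^+$ consists of the elements represented by a vector with non-negative entries. A trace on $G$ is a homomorphism $\tau:G\to\mathbb R$ with $\tau(G^+)\subseteq[0,\infty)$, and $\mathrm{Inf}(G)=\{g\in G:\tau(g)=0\text{ for every trace }\tau\}$. **Theorem.** Let $B$ be a simple Bratteli diagram with dimension group $G$, and let $\omega\in\mathcal P_B^*$. Suppose that there is no integer $j\ge 1$ such that $\omega$ has exactly $j$ maximal and exactly $j$ minimal infinite paths (equivalently, since $\omega$ is perfect: $X_{\max}(\omega)$ is infinite). Then $\mathrm{Inf}(G)$ contains a subgroup isomorphic to the free abelian group on countably infinitely many generators. -/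

import Mathlib

open Filter Topology

/-- A Bratteli diagram. `V n` is the set of vertices of level `n` and `E n` is the set of edges
from level `n` to level `n + 1`; `src` and `rng` are the source and range maps. -/
structure BratteliDiagram where
  V : ℕ → Type*
  E : ℕ → Type*
  src : ∀ {n : ℕ}, E n → V n
  rng : ∀ {n : ℕ}, E n → V (n + 1)
  finite_V : ∀ n, Finite (V n)
  finite_E : ∀ n, Finite (E n)
  unique_V_zero : Nonempty (Unique (V 0))
  src_surjective : ∀ n, Function.Surjective (src : E n → V n)
  rng_surjective : ∀ n, Function.Surjective (rng : E n → V (n + 1))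

namespace BratteliDiagram

attribute [instance] BratteliDiagram.finite_V BratteliDiagram.finite_E

noncomputable section

/-! ### Paths -/

/-- `B.FinPath v w` is the set `E(v, w)` of finite paths from the vertex `v` to the vertex `w`
(the empty path is allowed when `v = w`). -/
inductive FinPath (B : BratteliDiagram) {m : ℕ} (v : B.V m) : {n : ℕ} → B.V n → Type _
  | nil : FinPath B v v
  | snoc {n : ℕ} (e : B.E n) (p : FinPath B v (B.src e)) : FinPath B v (B.rng e)

/-- A Bratteli diagram is simple if for every level `n` there is a level `m > n` such that each
vertex of level `n` is connected by a path with each vertex of level `m`. -/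
def IsSimple (B : BratteliDiagram) : Prop :=
  ∀ n : ℕ, ∃ m : ℕ, n < m ∧ ∀ (v : B.V n) (w : B.V m), Nonempty (B.FinPath v w)

/-- The space `X_B` of infinite paths starting at the top vertex. -/
def PathSpace (B : BratteliDiagram) : Type _ :=
  {x : ∀ n, B.E n // ∀ n, B.rng (x n) = B.src (x (n + 1))}

/-- The topology of `X_B` generated by the cylinder sets: the coarsest one for which all the maps
`x ↦ x n` into the discrete sets `E n` are continuous. -/
instance (B : BratteliDiagram) : TopologicalSpace B.PathSpace :=
  ⨅ n : ℕ, TopologicalSpace.induced (fun x : B.PathSpace => x.1 n) ⊥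

/-- The vertex `v_n(x)` of level `n` through which the infinite path `x` passes. -/
def vertexAt (B : BratteliDiagram) (x : B.PathSpace) (n : ℕ) : B.V n := B.src (x.1 n)

/-! ### Orders on a Bratteli diagram -/

/-- The set `r⁻¹(v)` of edges with range `v`. -/
abbrev Incoming (B : BratteliDiagram) {n : ℕ} (v : B.V (n + 1)) : Type _ :=
  {e : B.E n // B.rng e = v}

/-- The set `O_B` of orders on `B`: an order is a linear order on each of the sets `r⁻¹(v)`. -/
def EdgeOrder (B : BratteliDiagram) : Type _ :=
  ∀ (n : ℕ) (v : B.V (n + 1)), LinearOrder (B.Incoming v)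

namespace EdgeOrder

variable {B : BratteliDiagram}

/-- The edge `e` is maximal in `r⁻¹(r(e))`. -/
def IsMaxEdge (ω : B.EdgeOrder) {n : ℕ} (e : B.E n) : Prop :=
  ∀ f : B.Incoming (B.rng e), (ω n (B.rng e)).le f ⟨e, rfl⟩

/-- The edge `e` is minimal in `r⁻¹(r(e))`. -/
def IsMinEdge (ω : B.EdgeOrder) {n : ℕ} (e : B.E n) : Prop :=
  ∀ f : B.Incoming (B.rng e), (ω n (B.rng e)).le ⟨e, rfl⟩ f

/-- The edge `f` is the successor of the edge `e` in `r⁻¹(r(e))`. -/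
def IsSuccEdge (ω : B.EdgeOrder) {n : ℕ} (e f : B.E n) : Prop :=
  ∃ h : B.rng f = B.rng e,
    letI := ω n (B.rng e)
    (⟨e, rfl⟩ : B.Incoming (B.rng e)) ⋖ ⟨f, h⟩

/-- A finite path is maximal if all its edges are. -/
def IsMaxFinPath (ω : B.EdgeOrder) {m : ℕ} {v : B.V m} :
    {n : ℕ} → {w : B.V n} → B.FinPath v w → Prop
  | _, _, .nil => True
  | _, _, .snoc e p => ω.IsMaxEdge e ∧ ω.IsMaxFinPath p

/-- A finite path is minimal if all its edges are. -/
def IsMinFinPath (ω : B.EdgeOrder) {m : ℕ} {v : B.V m} :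
    {n : ℕ} → {w : B.V n} → B.FinPath v w → Prop
  | _, _, .nil => True
  | _, _, .snoc e p => ω.IsMinEdge e ∧ ω.IsMinFinPath p

/-- The set `X_max(ω)` of maximal infinite paths. -/
def maxPaths (ω : B.EdgeOrder) : Set B.PathSpace := {x | ∀ n, ω.IsMaxEdge (x.1 n)}

/-- The set `X_min(ω)` of minimal infinite paths. -/
def minPaths (ω : B.EdgeOrder) : Set B.PathSpace := {x | ∀ n, ω.IsMinEdge (x.1 n)}

/-- The graph of the Vershik map `φ_ω : X_B \ X_max(ω) → X_B \ X_min(ω)`: if `x k` is the first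
edge of `x` that is not maximal, then `y = φ_ω(x)` is obtained by replacing `x k` with its
successor, the edges before it with minimal edges, and by keeping the edges after it. -/
def IsVershikImage (ω : B.EdgeOrder) (x y : B.PathSpace) : Prop :=
  ∃ k : ℕ, (∀ i < k, ω.IsMaxEdge (x.1 i)) ∧ (∀ i < k, ω.IsMinEdge (y.1 i)) ∧
    ω.IsSuccEdge (x.1 k) (y.1 k) ∧ ∀ i > k, y.1 i = x.1 i

/-- The order `ω` is perfect if its Vershik map extends to a homeomorphism of `X_B`. -/
def IsPerfect (ω : B.EdgeOrder) : Prop :=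
  ∃ φ : B.PathSpace ≃ₜ B.PathSpace, ∀ x ∉ ω.maxPaths, ω.IsVershikImage x (φ x)

/-! ### Language, extremal vertices, and the maps `σ_n` -/

/-- The edges with range `v`, listed in increasing order. -/
def incomingList (ω : B.EdgeOrder) {n : ℕ} (v : B.V (n + 1)) : List (B.Incoming v) :=
  letI := ω n v
  letI := Fintype.ofFinite (B.Incoming v)
  (Finset.univ : Finset (B.Incoming v)).sort (· ≤ ·)

/-- The word `w(v, n, n + k)` over the alphabet `V n`: the sources of all paths from level `n` to
the vertex `v` of level `n + k`, listed in the increasing lexicographic order. As the last edges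
are compared first in that order, the word of `v` is the concatenation, over the edges `e` with
range `v` in increasing order, of the words of the sources of `e`. -/
def word (ω : B.EdgeOrder) (n : ℕ) : (k : ℕ) → B.V (n + k) → List (B.V n)
  | 0, v => [v]
  | k + 1, v => (ω.incomingList (n := n + k) v).flatMap fun e => ω.word n k (B.src e.1)

/-- The level-`n` language: all (contiguous) subwords of the words `w(v, n, N)` with `N > n`. -/
def language (ω : B.EdgeOrder) (n : ℕ) : Set (List (B.V n)) :=
  {W | ∃ k : ℕ, 0 < k ∧ ∃ v : B.V (n + k), W <:+: ω.word n k v}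

/-- The maximal vertices of level `n`: those through which a maximal infinite path passes. -/
def maxVertices (ω : B.EdgeOrder) (n : ℕ) : Set (B.V n) :=
  {v | ∃ M ∈ ω.maxPaths, B.vertexAt M n = v}

/-- The minimal vertices of level `n`: those through which a minimal infinite path passes. -/
def minVertices (ω : B.EdgeOrder) (n : ℕ) : Set (B.V n) :=
  {v | ∃ m ∈ ω.minPaths, B.vertexAt m n = v}

/-- `σ_n(a)` is the set of the minimal vertices `b` such that the word `ab` is in the level-`n`
language. -/
def corr (ω : B.EdgeOrder) (n : ℕ) (a : B.V n) : Set (B.V n) :=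
  {b | b ∈ ω.minVertices n ∧ [a, b] ∈ ω.language n}

/-- `σ_n⁻¹(b)` is the set of the maximal vertices `a` with `b ∈ σ_n(a)`. -/
def corrInv (ω : B.EdgeOrder) (n : ℕ) (b : B.V n) : Set (B.V n) :=
  {a | a ∈ ω.maxVertices n ∧ b ∈ ω.corr n a}

/-- Telescoping `B` to the levels `0 = ℓ 0 < ℓ 1 < …` gives an ordered diagram that has a skeleton:
in the telescoped diagram every maximal edge has its source in a maximal vertex, and every minimal
edge has its source in a minimal vertex. (A maximal edge of the telescoped diagram is a maximal
finite path of `B` between two consecutive levels `ℓ k` and `ℓ (k + 1)`.) -/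
def IsSkeletonLevels (ω : B.EdgeOrder) (ℓ : ℕ → ℕ) : Prop :=
  ℓ 0 = 0 ∧ StrictMono ℓ ∧
    ∀ (k : ℕ) (u : B.V (ℓ k)) (v : B.V (ℓ (k + 1))) (p : B.FinPath u v),
      (ω.IsMaxFinPath p → u ∈ ω.maxVertices (ℓ k)) ∧
      (ω.IsMinFinPath p → u ∈ ω.minVertices (ℓ k))

end EdgeOrder

/-- The set `P_B` of perfect orders on `B`. -/
def perfectOrders (B : BratteliDiagram) : Set B.EdgeOrder := {ω | ω.IsPerfect}

/-- The set `O_B(j)` of the orders with exactly `j` maximal and exactly `j` minimal paths. -/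
def ordersWith (B : BratteliDiagram) (j : ℕ) : Set B.EdgeOrder :=
  {ω | ω.maxPaths.encard = j ∧ ω.minPaths.encard = j}

/-- The set `P_B^*`: the perfect orders `ω` such that, after a telescoping for which `ω` has a
skeleton, `σ_n(v_n(M))` is a single vertex for all large `n`, for each maximal path `M`, and
`σ_n⁻¹(v_n(m))` is a single vertex for all large `n`, for each minimal path `m`. Telescoping does
not change the extremal paths and the vertices and languages of the levels that are kept, so that
all this is expressed in `B` itself, at the levels `ℓ k` of the telescoping. When `B` already has
a skeleton and satisfies the condition, no telescoping is needed: `ℓ k = k`. -/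
def perfectStarOrders (B : BratteliDiagram) : Set B.EdgeOrder :=
  {ω | ω ∈ B.perfectOrders ∧ ∃ ℓ : ℕ → ℕ, ω.IsSkeletonLevels ℓ ∧
    (∀ M ∈ ω.maxPaths, ∀ᶠ k in atTop, ∃ b, ω.corr (ℓ k) (B.vertexAt M (ℓ k)) = {b}) ∧
    (∀ m ∈ ω.minPaths, ∀ᶠ k in atTop, ∃ a, ω.corrInv (ℓ k) (B.vertexAt m (ℓ k)) = {a})}

/-! ### The dimension group -/

instance (B : BratteliDiagram) (n : ℕ) : Fintype (B.V n) := Fintype.ofFinite _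

/-- The incidence matrix `F_n`: its entry at `(v, w)` is the number of edges from the vertex `w`
of level `n` to the vertex `v` of level `n + 1`. -/
def incidence (B : BratteliDiagram) (n : ℕ) : Matrix (B.V (n + 1)) (B.V n) ℤ :=
  Matrix.of fun v w => (Nat.card {e : B.E n // B.rng e = v ∧ B.src e = w} : ℤ)

/-- The map `F_{j-1} ∘ ⋯ ∘ F_i` from the vectors of level `i` to the vectors of level `j`. -/
def transition (B : BratteliDiagram) (i j : ℕ) (h : i ≤ j) :
    (B.V i → ℤ) →ₗ[ℤ] (B.V j → ℤ) :=
  Nat.leRecOn (C := fun k => (B.V i → ℤ) →ₗ[ℤ] (B.V k → ℤ)) h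
    (fun {k} g => (B.incidence k).mulVecLin ∘ₗ g) LinearMap.id

/-- The dimension group `G` of `B`: the direct limit of the groups `ℤ^{V n}` along the incidence
matrices. -/
abbrev DimensionGroup (B : BratteliDiagram) : Type _ :=
  Module.DirectLimit (R := ℤ) (fun n : ℕ => B.V n → ℤ) B.transition

/-- The positive cone `G⁺`: the elements represented by a non-negative vector of some level. -/
def positiveCone (B : BratteliDiagram) : Set B.DimensionGroup :=
  {g | ∃ (n : ℕ) (x : B.V n → ℤ), 0 ≤ x ∧
    g = Module.DirectLimit.of ℤ ℕ (fun n : ℕ => B.V n → ℤ) B.transition n x}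

/-- A trace on `G`: a positive homomorphism from `G` to the real numbers. (Normalizing nonzero
traces at an order unit does not change the infinitesimal subgroup below.) -/
def IsTrace (B : BratteliDiagram) (τ : B.DimensionGroup →+ ℝ) : Prop :=
  ∀ g ∈ B.positiveCone, 0 ≤ τ g

/-- The infinitesimal subgroup `Inf(G)`: the elements on which every trace on `G` vanishes. -/
def infinitesimals (B : BratteliDiagram) : AddSubgroup B.DimensionGroup where
  carrier := {g | ∀ τ : B.DimensionGroup →+ ℝ, B.IsTrace τ → τ g = 0}
  zero_mem' := fun τ _ => map_zero τ
  add_mem' := fun ha hb τ hτ => by rw [map_add, ha τ hτ, hb τ hτ, add_zero]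
  neg_mem' := fun ha τ hτ => by rw [map_neg, ha τ hτ, neg_zero]

end

end BratteliDiagram

namespace BratteliDiagram

noncomputable section

variable {B : BratteliDiagram}

/-! ### Constructing infinite paths -/

/-! Let φ be the homeomorphism extending the Vershik map. For a locally constant integer function f,
sum f − f∘φ⁻¹ over the tower of paths from the top vertex to a vertex v of level n. Since φ moves
each floor to the next, the sum telescopes to f(top) − f(φ⁻¹(bottom)). For large n these vectors are
compatible with the incidence matrices (`incidence_coboundary`), so they define a homomorphism
`coboundaryClass` into the dimension group.

Its values are infinitesimal: the entries are at most 2·sup|f| in absolute value, while simplicity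
and the infinitude of X_max make the tower heights at suitable levels arbitrarily large
(`exists_le_heights`).

Its kernel is small: if the class of f is zero, then f(top) = f(φ⁻¹(bottom)) for every late tower.
As φ joins the top below an edge to the bottom below its successor, the value of f at tower tops
does not change along edges, and simplicity forces f to be constant on X_max
(`eq_of_coboundaryClass_eq_zero`). Indicators of clopen sets separating infinitely many maximal
paths therefore generate a free group on which the class is injective. -/

theorem vertexAt_succ (x : B.PathSpace) (n : ℕ) : B.vertexAt x (n + 1) = B.rng (x.1 n) :=
  (x.2 n).symm

instance : Subsingleton (B.V 0) := by
  obtain ⟨h⟩ := B.unique_V_zero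
  infer_instance

instance : Nonempty (B.V 0) := by
  obtain ⟨h⟩ := B.unique_V_zero
  infer_instance

instance nonempty_vertices (n : ℕ) : Nonempty (B.V n) := by
  induction n with
  | zero => infer_instance
  | succ n ih =>
    obtain ⟨v⟩ := ih
    obtain ⟨e, -⟩ := B.src_surjective n v
    exact ⟨B.rng e⟩

/-- A choice of an outgoing edge at each vertex determines an infinite path. -/
theorem exists_follow (up : ∀ n, B.V n → B.E n) (h : ∀ n v, B.src (up n v) = v) :
    ∃ z : B.PathSpace, ∀ n, z.1 n = up n (B.vertexAt z n) := by
  obtain ⟨v₀⟩ : Nonempty (B.V 0) := inferInstance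
  let z : ∀ n, B.E n := fun n => Nat.rec (up 0 v₀) (fun k e => up (k + 1) (B.rng e)) n
  refine ⟨⟨z, fun n => (h (n + 1) (B.rng (z n))).symm⟩, fun n => ?_⟩
  cases n with
  | zero => exact congrArg (up 0) (Subsingleton.elim _ _)
  | succ n =>
    change up (n + 1) (B.rng (z n)) = up (n + 1) (B.src (up (n + 1) (B.rng (z n))))
    rw [h]

instance : Nonempty B.PathSpace := by
  choose up h using B.src_surjective
  obtain ⟨z, -⟩ := exists_follow up h
  exact ⟨z⟩

open Classical in
/-- The first `n` edges of a path can be continued with any edge that starts where they end. -/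
theorem exists_extend (x : B.PathSpace) {n : ℕ} (e : B.E n) (he : B.src e = B.vertexAt x n) :
    ∃ z : B.PathSpace, (∀ i < n, z.1 i = x.1 i) ∧ z.1 n = e := by
  choose up₀ h₀ using B.src_surjective
  let up₁ : ∀ i, B.V i → B.E i := fun i v => if v = B.vertexAt x i then x.1 i else up₀ i v
  have h₁ : ∀ i v, B.src (up₁ i v) = v := by
    intro i v
    by_cases hv : v = B.vertexAt x i
    · simp only [up₁, if_pos hv]
      exact hv.symm
    · simp only [up₁, if_neg hv, h₀]
  -- Follow `x` wherever it is met, except that at level `n` the vertex `B.src e` is left through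
  -- `e`.
  let up := Function.update up₁ n (Function.update (up₁ n) (B.src e) e)
  have hup : ∀ i v, B.src (up i v) = v := by
    intro i v
    by_cases hi : i = n
    · subst hi
      by_cases hv : v = B.src e
      · subst hv
        simp [up]
      · simp [up, Function.update_of_ne hv, h₁]
    · simp [up, Function.update_of_ne hi, h₁]
  obtain ⟨z, hz⟩ := exists_follow up hup
  have key : ∀ i ≤ n, B.vertexAt z i = B.vertexAt x i ∧ ∀ j < i, z.1 j = x.1 j := by
    intro i
    induction i with
    | zero => exact fun _ => ⟨Subsingleton.elim _ _, fun j hj => absurd hj (by omega)⟩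
    | succ i ih =>
      intro hi
      obtain ⟨h1, h2⟩ := ih (by omega)
      have h3 : z.1 i = x.1 i := by
        rw [hz, h1]
        simp [up, Function.update_of_ne (show i ≠ n by omega), up₁]
      refine ⟨by rw [vertexAt_succ, vertexAt_succ, h3], fun j hj => ?_⟩
      rcases Nat.lt_succ_iff_lt_or_eq.mp hj with hj | rfl
      · exact h2 j hj
      · exact h3
  refine ⟨z, (key n le_rfl).2, ?_⟩
  rw [hz, (key n le_rfl).1, ← he]
  simp [up]

/-- Any edge lies on an infinite path whose earlier edges are prescribed by their ranges. -/
theorem exists_path_through (down : ∀ n, B.V (n + 1) → B.E n)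
    (h : ∀ n v, B.rng (down n v) = v) (n : ℕ) (e : B.E n) :
    ∃ x : B.PathSpace, x.1 n = e ∧ ∀ i < n, x.1 i = down i (B.rng (x.1 i)) := by
  induction n with
  | zero =>
    obtain ⟨x⟩ : Nonempty B.PathSpace := inferInstance
    obtain ⟨z, -, hz⟩ := exists_extend x e (Subsingleton.elim _ _)
    exact ⟨z, hz, fun i hi => absurd hi (by omega)⟩
  | succ n ih =>
    obtain ⟨x, hx, hx'⟩ := ih (down n (B.src e))
    obtain ⟨z, hz, hz'⟩ := exists_extend x e (by rw [vertexAt_succ, hx, h])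
    refine ⟨z, hz', fun i hi => ?_⟩
    rw [hz i hi]
    rcases Nat.lt_succ_iff_lt_or_eq.mp hi with hi | rfl
    · exact hx' i hi
    · rw [hx, h]

/-- The path that follows `x` up to level `n`, and `y` after it. -/
def splice (x y : B.PathSpace) (n : ℕ) (h : B.vertexAt x n = B.vertexAt y n) : B.PathSpace :=
  ⟨fun i => if i < n then x.1 i else y.1 i, fun i => by
    change B.rng (if i < n then x.1 i else y.1 i) =
      B.src (if i + 1 < n then x.1 (i + 1) else y.1 (i + 1))
    rcases lt_trichotomy (i + 1) n with hi | hi | hi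
    · rw [if_pos (by omega), if_pos hi, x.2]
    · subst hi
      rw [if_pos (by omega), if_neg (by omega), ← vertexAt_succ, h]
      rfl
    · rw [if_neg (by omega), if_neg (by omega), y.2]⟩

theorem splice_of_lt {x y : B.PathSpace} {n : ℕ} (h : B.vertexAt x n = B.vertexAt y n) {i : ℕ}
    (hi : i < n) : (splice x y n h).1 i = x.1 i := if_pos hi

theorem splice_of_le {x y : B.PathSpace} {n : ℕ} (h : B.vertexAt x n = B.vertexAt y n) {i : ℕ}
    (hi : n ≤ i) : (splice x y n h).1 i = y.1 i := if_neg (not_lt.mpr hi)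

/-! ### Extremal edges and successors -/

namespace EdgeOrder

variable (ω : B.EdgeOrder)

/-- The order in which the incoming edges of every vertex are reversed. -/
def dual : B.EdgeOrder := fun n v =>
  letI := ω n v
  (inferInstance : LinearOrder (B.Incoming v)ᵒᵈ)

instance nonempty_incoming {n : ℕ} (v : B.V (n + 1)) : Nonempty (B.Incoming v) := by
  obtain ⟨e, he⟩ := B.rng_surjective n v
  exact ⟨⟨e, he⟩⟩

theorem isMaxEdge_iff {n : ℕ} {v : B.V (n + 1)} (e : B.Incoming v) :
    ω.IsMaxEdge e.1 ↔ ∀ f : B.Incoming v, (ω n v).le f e := by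
  obtain ⟨e, rfl⟩ := e
  rfl

theorem isMinEdge_iff {n : ℕ} {v : B.V (n + 1)} (e : B.Incoming v) :
    ω.IsMinEdge e.1 ↔ ∀ f : B.Incoming v, (ω n v).le e f := by
  obtain ⟨e, rfl⟩ := e
  rfl

theorem isSuccEdge_iff {n : ℕ} {v : B.V (n + 1)} (e f : B.Incoming v) :
    ω.IsSuccEdge e.1 f.1 ↔ (letI := ω n v; e ⋖ f) := by
  obtain ⟨e, rfl⟩ := e
  exact ⟨fun ⟨_, h⟩ => h, fun h => ⟨f.2, h⟩⟩

theorem exists_isMaxEdge {n : ℕ} (v : B.V (n + 1)) : ∃ e : B.E n, B.rng e = v ∧ ω.IsMaxEdge e := by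
  let := ω n v
  obtain ⟨e, he⟩ := Finite.exists_max (id : B.Incoming v → B.Incoming v)
  exact ⟨e.1, e.2, (ω.isMaxEdge_iff e).2 he⟩

variable {ω}

theorem IsMaxEdge.eq {n : ℕ} {e f : B.E n} (he : ω.IsMaxEdge e) (hf : ω.IsMaxEdge f)
    (h : B.rng e = B.rng f) : e = f := by
  have h1 := (ω.isMaxEdge_iff ⟨e, h⟩).1 he ⟨f, rfl⟩
  exact congrArg Subtype.val ((ω n (B.rng f)).le_antisymm _ _ (hf ⟨e, h⟩) h1)

theorem IsSuccEdge.rng_eq {n : ℕ} {e f : B.E n} (h : ω.IsSuccEdge e f) : B.rng f = B.rng e := h.1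

theorem IsSuccEdge.not_isMaxEdge {n : ℕ} {e f : B.E n} (h : ω.IsSuccEdge e f) :
    ¬ ω.IsMaxEdge e := by
  intro he
  obtain ⟨hr, hc⟩ := h
  let := ω n (B.rng e)
  exact absurd (he ⟨f, hr⟩) (not_le.mpr hc.lt)

theorem IsSuccEdge.not_isMinEdge {n : ℕ} {e f : B.E n} (h : ω.IsSuccEdge e f) :
    ¬ ω.IsMinEdge f := by
  intro hf
  obtain ⟨hr, hc⟩ := h
  let := ω n (B.rng e)
  exact absurd ((ω.isMinEdge_iff ⟨f, hr⟩).1 hf ⟨e, rfl⟩) (not_le.mpr hc.lt)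

theorem IsSuccEdge.right_unique {n : ℕ} {e f g : B.E n} (hf : ω.IsSuccEdge e f)
    (hg : ω.IsSuccEdge e g) : f = g := by
  obtain ⟨hr, hc⟩ := hf
  obtain ⟨hr', hc'⟩ := hg
  let := ω n (B.rng e)
  exact congrArg Subtype.val (hc.unique_right hc')

theorem exists_isSuccEdge_of_not_isMinEdge {n : ℕ} {f : B.E n} (hf : ¬ ω.IsMinEdge f) :
    ∃ e, ω.IsSuccEdge e f := by
  let := ω n (B.rng f)
  have h : ¬ IsMin (⟨f, rfl⟩ : B.Incoming (B.rng f)) :=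
    fun h => hf fun g => isMin_iff_forall_not_lt.mp h |> fun h' => not_lt.mp (h' g)
  let := Fintype.ofFinite (B.Incoming (B.rng f))
  let : LocallyFiniteOrder (B.Incoming (B.rng f)) := Fintype.toLocallyFiniteOrder
  obtain ⟨a, ha⟩ := not_isMin_iff.mp h
  obtain ⟨e, -, he⟩ := exists_le_covBy_of_lt ha
  exact ⟨e.1, (ω.isSuccEdge_iff e ⟨f, rfl⟩).2 he⟩

/-! ### Paths that are extremal up to a level -/

variable (ω) in
theorem exists_max_prefix_edge (n : ℕ) (e : B.E n) :
    ∃ x : B.PathSpace, x.1 n = e ∧ ∀ i < n, ω.IsMaxEdge (x.1 i) := by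
  choose down h₁ h₂ using fun (n : ℕ) (v : B.V (n + 1)) => ω.exists_isMaxEdge v
  obtain ⟨x, hx, hx'⟩ := exists_path_through down h₁ n e
  exact ⟨x, hx, fun i hi => hx' i hi ▸ h₂ i _⟩

variable (ω) in
theorem exists_max_prefix (n : ℕ) (v : B.V n) :
    ∃ x : B.PathSpace, B.vertexAt x n = v ∧ ∀ i < n, ω.IsMaxEdge (x.1 i) := by
  obtain ⟨e, rfl⟩ := B.src_surjective n v
  obtain ⟨x, rfl, hx⟩ := ω.exists_max_prefix_edge n e
  exact ⟨x, rfl, hx⟩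

/-- A vertex has only one maximal incoming edge, and its source is the next vertex down, so the
prefix is determined by descent. -/
theorem max_prefix_unique {x y : B.PathSpace} {n : ℕ} (hx : ∀ i < n, ω.IsMaxEdge (x.1 i))
    (hy : ∀ i < n, ω.IsMaxEdge (y.1 i)) (h : B.vertexAt x n = B.vertexAt y n) :
    ∀ i < n, x.1 i = y.1 i := by
  induction n with
  | zero => exact fun i hi => absurd hi (by omega)
  | succ n ih =>
    rw [vertexAt_succ, vertexAt_succ] at h
    have hn := (hx n (by omega)).eq (hy n (by omega)) h
    intro i hi
    rcases Nat.lt_succ_iff_lt_or_eq.mp hi with hi | rfl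
    · exact ih (fun i hi => hx i (by omega)) (fun i hi => hy i (by omega))
        (congrArg B.src hn) i hi
    · exact hn

/-- An infinite path through `v` whose edges before level `n` are maximal. -/
def maxTo (ω : B.EdgeOrder) (n : ℕ) (v : B.V n) : B.PathSpace := (ω.exists_max_prefix n v).choose

/-- An infinite path through `v` whose edges before level `n` are minimal. -/
def minTo (ω : B.EdgeOrder) (n : ℕ) (v : B.V n) : B.PathSpace := ω.dual.maxTo n v

theorem vertexAt_maxTo (n : ℕ) (v : B.V n) : B.vertexAt (ω.maxTo n v) n = v :=
  (ω.exists_max_prefix n v).choose_spec.1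

theorem isMaxEdge_maxTo (n : ℕ) (v : B.V n) : ∀ i < n, ω.IsMaxEdge ((ω.maxTo n v).1 i) :=
  (ω.exists_max_prefix n v).choose_spec.2

/-- The chosen path is arbitrary beyond level `n`; functions of the first `n` edges do not see that
choice. -/
theorem maxTo_prefix {n : ℕ} {x : B.PathSpace} (hx : ∀ i < n, ω.IsMaxEdge (x.1 i)) :
    ∀ i < n, (ω.maxTo n (B.vertexAt x n)).1 i = x.1 i :=
  max_prefix_unique (isMaxEdge_maxTo n _) hx (vertexAt_maxTo n _)

theorem vertexAt_minTo (n : ℕ) (v : B.V n) : B.vertexAt (ω.minTo n v) n = v :=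
  ω.dual.vertexAt_maxTo n v

theorem isMinEdge_minTo (n : ℕ) (v : B.V n) : ∀ i < n, ω.IsMinEdge ((ω.minTo n v).1 i) :=
  ω.dual.isMaxEdge_maxTo n v

theorem minTo_prefix {n : ℕ} {x : B.PathSpace} (hx : ∀ i < n, ω.IsMinEdge (x.1 i)) :
    ∀ i < n, (ω.minTo n (B.vertexAt x n)).1 i = x.1 i :=
  ω.dual.maxTo_prefix hx

/-! ### The Vershik map -/

theorem IsVershikImage.unique {x y z : B.PathSpace} (hy : ω.IsVershikImage x y)
    (hz : ω.IsVershikImage x z) : y = z := by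
  obtain ⟨k, h1, h2, h3, h4⟩ := hy
  obtain ⟨l, g1, g2, g3, g4⟩ := hz
  have hkl : k = l := by
    rcases lt_trichotomy k l with h | h | h
    · exact absurd (g1 k h) h3.not_isMaxEdge
    · exact h
    · exact absurd (h1 l h) g3.not_isMaxEdge
  subst hkl
  have hk := h3.right_unique g3
  apply Subtype.ext
  funext i
  rcases lt_trichotomy i k with h | h | h
  · exact max_prefix_unique (ω := ω.dual) h2 g2 (congrArg B.src hk) i h
  · subst h
    exact hk
  · rw [h4 i h, g4 i h]

theorem IsVershikImage.left_notMem {x y : B.PathSpace} (h : ω.IsVershikImage x y) :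
    x ∉ ω.maxPaths := by
  obtain ⟨k, -, -, h, -⟩ := h
  exact fun hx => h.not_isMaxEdge (hx k)

theorem IsVershikImage.right_notMem {x y : B.PathSpace} (h : ω.IsVershikImage x y) :
    y ∉ ω.minPaths := by
  obtain ⟨k, -, -, h, -⟩ := h
  exact fun hx => h.not_isMinEdge (hx k)

-- The Vershik map is inverted by replacing the first non-minimal edge by its predecessor and
-- putting maximal edges below it.
open Classical in
theorem exists_isVershikImage {y : B.PathSpace} (hy : y ∉ ω.minPaths) :
    ∃ x, ω.IsVershikImage x y := by
  have hex : ∃ k, ¬ ω.IsMinEdge (y.1 k) := by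
    by_contra! h
    exact hy h
  let k := Nat.find hex
  obtain ⟨e, he⟩ := exists_isSuccEdge_of_not_isMinEdge (Nat.find_spec hex)
  obtain ⟨x, hx, hx'⟩ := ω.exists_max_prefix_edge k e
  have hv : B.vertexAt x (k + 1) = B.vertexAt y (k + 1) := by
    rw [vertexAt_succ, vertexAt_succ, hx, he.rng_eq]
  refine ⟨splice x y (k + 1) hv, k, fun i hi => ?_, fun i hi => ?_, ?_, fun i hi => ?_⟩
  · rw [splice_of_lt hv (by omega)]
    exact hx' i hi
  · exact not_not.mp (Nat.find_min hex hi)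
  · rw [splice_of_lt hv (by omega), hx]
    exact he
  · rw [splice_of_le hv (by omega)]

/-- Off the maximal paths φ is a bijection onto the non-minimal paths, so it must match the two
complements. -/
theorem image_maxPaths {φ : B.PathSpace ≃ₜ B.PathSpace}
    (hφ : ∀ x ∉ ω.maxPaths, ω.IsVershikImage x (φ x)) : φ '' ω.maxPaths = ω.minPaths := by
  ext y
  constructor
  · rintro ⟨x, hx, rfl⟩
    by_contra h
    obtain ⟨z, hz⟩ := exists_isVershikImage h
    have := φ.injective ((hφ z hz.left_notMem).unique hz)
    exact hz.left_notMem (this ▸ hx)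
  · intro hy
    refine ⟨φ.symm y, ?_, φ.apply_symm_apply y⟩
    by_contra h
    have := (hφ _ h).right_notMem
    rw [φ.apply_symm_apply] at this
    exact this hy

/-- The Vershik map sends the tower top below an edge to the tower bottom below its successor. -/
theorem exists_vershik_pair {φ : B.PathSpace ≃ₜ B.PathSpace}
    (hφ : ∀ x ∉ ω.maxPaths, ω.IsVershikImage x (φ x)) {n : ℕ} {e f : B.E n}
    (h : ω.IsSuccEdge e f) :
    ∃ x : B.PathSpace, (∀ i < n, ω.IsMaxEdge (x.1 i)) ∧ B.vertexAt x n = B.src e ∧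
      (∀ i < n, ω.IsMinEdge ((φ x).1 i)) ∧ B.vertexAt (φ x) n = B.src f := by
  obtain ⟨x, rfl, hx'⟩ := ω.exists_max_prefix_edge n e
  obtain ⟨k, h1, h2, h3, h4⟩ := hφ x fun hx => h.not_isMaxEdge (hx n)
  -- The first non-maximal edge of `x` is the one at `n`: the earlier edges are maximal, and `x.1 n`
  -- has a successor.
  have hkn : k = n := by
    rcases lt_trichotomy k n with h' | h' | h'
    · exact absurd (hx' k h') h3.not_isMaxEdge
    · exact h'
    · exact absurd (h1 n h') h.not_isMaxEdge
  subst hkn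
  exact ⟨x, hx', rfl, h2, congrArg B.src (h3.right_unique h)⟩

end EdgeOrder

/-! ### The topology of the path space -/

theorem continuous_edge (n : ℕ) :
    @Continuous B.PathSpace (B.E n) _ ⊥ (fun x => x.1 n) :=
  continuous_iff_le_induced.mpr (iInf_le _ n)

theorem isOpen_cylinder (x : B.PathSpace) (n : ℕ) :
    IsOpen {y : B.PathSpace | ∀ i < n, y.1 i = x.1 i} := by
  have : {y : B.PathSpace | ∀ i < n, y.1 i = x.1 i} =
      ⋂ i ∈ Finset.range n, {y : B.PathSpace | y.1 i = x.1 i} := by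
    ext y
    simp
  rw [this]
  refine isOpen_biInter_finset fun i _ => ?_
  exact @IsOpen.preimage _ _ _ ⊥ _ (continuous_edge i) {x.1 i} trivial

theorem isClosed_edge (n : ℕ) (S : Set (B.E n)) : IsClosed {y : B.PathSpace | y.1 n ∈ S} :=
  @IsClosed.preimage _ _ _ ⊥ _ (continuous_edge n) S (by
    let : TopologicalSpace (B.E n) := ⊥
    have : DiscreteTopology (B.E n) := ⟨rfl⟩
    exact isClosed_discrete S)

theorem isClopen_cylinder (x : B.PathSpace) (n : ℕ) :
    IsClopen {y : B.PathSpace | ∀ i < n, y.1 i = x.1 i} := by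
  refine ⟨?_, isOpen_cylinder x n⟩
  simp only [Set.ofPred_forall]
  exact isClosed_iInter fun i => isClosed_iInter fun _ => isClosed_edge i {x.1 i}

/-- In the infimum topology a basic neighbourhood fixes finitely many edges; a bound on their
indices gives a cylinder. -/
theorem exists_cylinder_subset {x : B.PathSpace} {W : Set B.PathSpace} (hW : W ∈ 𝓝 x) :
    ∃ n, {y : B.PathSpace | ∀ i < n, y.1 i = x.1 i} ⊆ W := by
  have hn : 𝓝 x = ⨅ n : ℕ, 𝓟 {y : B.PathSpace | y.1 n = x.1 n} := by
    rw [show (𝓝 x) = _ from nhds_iInf]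
    refine iInf_congr fun n => ?_
    let : TopologicalSpace (B.E n) := ⊥
    have : DiscreteTopology (B.E n) := ⟨rfl⟩
    rw [nhds_induced, nhds_discrete, ← principal_singleton, comap_principal]
    rfl
  rw [hn, (hasBasis_iInf_principal_finite _).mem_iff] at hW
  obtain ⟨t, ht, hW⟩ := hW
  obtain ⟨n, hn⟩ := ht.bddAbove
  exact ⟨n + 1, fun y hy => hW (Set.mem_iInter₂.mpr fun i hi =>
    hy i (Nat.lt_succ_of_le (hn hi)))⟩

instance : T2Space B.PathSpace := by
  refine ⟨fun x y hxy => ?_⟩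
  obtain ⟨n, hn⟩ : ∃ n, x.1 n ≠ y.1 n := by
    by_contra! h
    exact hxy (Subtype.ext (funext h))
  refine ⟨_, _, isOpen_cylinder x (n + 1), isOpen_cylinder y (n + 1), fun i _ => rfl,
    fun i _ => rfl, ?_⟩
  rw [Set.disjoint_left]
  exact fun z hz hz' => hn ((hz n (by omega)).symm.trans (hz' n (by omega)))

/-- The path condition is closed in the product of the finite discrete sets of edges. -/
instance : CompactSpace B.PathSpace := by
  let (n : ℕ) : TopologicalSpace (B.E n) := ⊥
  have (n : ℕ) : DiscreteTopology (B.E n) := ⟨rfl⟩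
  have hind : Topology.IsInducing (fun x : B.PathSpace => x.1) := by
    constructor
    change (⨅ n : ℕ, _) = TopologicalSpace.induced _ (⨅ n : ℕ, _)
    rw [induced_iInf]
    simp only [induced_compose]
    rfl
  have hcl : IsClosed (Set.range (fun x : B.PathSpace => x.1)) := by
    have : Set.range (fun x : B.PathSpace => x.1) =
        ⋂ n, {x : ∀ n, B.E n | B.rng (x n) = B.src (x (n + 1))} := by
      ext x
      simp only [Set.mem_range, Set.mem_iInter]
      exact ⟨fun ⟨y, hy⟩ => hy ▸ y.2, fun h => ⟨⟨x, h⟩, rfl⟩⟩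
    rw [this]
    refine isClosed_iInter fun n => ?_
    let : TopologicalSpace (B.V (n + 1)) := ⊥
    have : DiscreteTopology (B.V (n + 1)) := ⟨rfl⟩
    exact isClosed_eq (continuous_of_discreteTopology.comp (continuous_apply n))
      (continuous_of_discreteTopology.comp (continuous_apply (n + 1)))
  exact (Topology.IsClosedEmbedding.mk ⟨hind, Subtype.val_injective⟩ hcl).compactSpace

/-- A locally constant function on the path space depends on finitely many edges only. -/
theorem exists_level (f : LocallyConstant B.PathSpace ℤ) :
    ∃ n, ∀ x y : B.PathSpace, (∀ i < n, y.1 i = x.1 i) → f y = f x := by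
  let O : ℕ → Set B.PathSpace := fun n => {x | ∀ y, (∀ i < n, y.1 i = x.1 i) → f y = f x}
  have hO : ∀ n, IsOpen (O n) := by
    intro n
    rw [isOpen_iff_mem_nhds]
    intro x hx
    filter_upwards [(isOpen_cylinder x n).mem_nhds fun i _ => rfl] with y hy z hz
    rw [hx z fun i hi => (hz i hi).trans (hy i hi), hx y hy]
  have hmono : Monotone O := fun m n hmn x hx y hy => hx y fun i hi => hy i (by omega)
  have hcov : Set.univ ⊆ ⋃ n, O n := by
    intro x _
    obtain ⟨n, hn⟩ := exists_cylinder_subset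
      ((f.isLocallyConstant.isOpen_fiber (f x)).mem_nhds rfl)
    exact Set.mem_iUnion.mpr ⟨n, fun y hy => hn hy⟩
  -- The open sets `O n` increase and cover the compact path space, so one of them is everything.
  obtain ⟨n, hn⟩ := isCompact_univ.elim_directed_cover O hO hcov
    (directed_of_isDirected_le hmono)
  exact ⟨n, fun x => hn (Set.mem_univ x)⟩

theorem maxPaths_nonempty (ω : B.EdgeOrder) : ω.maxPaths.Nonempty := by
  let Z : ℕ → Set B.PathSpace := fun n => {x | ∀ i < n, ω.IsMaxEdge (x.1 i)}
  have hcl : ∀ n, IsClosed (Z n) := by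
    intro n
    simp only [Z, Set.ofPred_forall]
    exact isClosed_iInter fun i => isClosed_iInter fun _ => isClosed_edge i {e | ω.IsMaxEdge e}
  obtain ⟨x, hx⟩ := IsCompact.nonempty_iInter_of_sequence_nonempty_isCompact_isClosed Z
    (fun n x hx i hi => hx i (by omega))
    (fun n => ⟨ω.maxTo n (Classical.arbitrary _), ω.isMaxEdge_maxTo n _⟩)
    (hcl 0).isCompact hcl
  exact ⟨x, fun n => Set.mem_iInter.mp hx (n + 1) n (by omega)⟩

/-- A finite X_max is nonempty and φ carries it onto X_min, so both would have the same positive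
number of elements. -/
theorem maxPaths_infinite {ω : B.EdgeOrder} (hω : ω.IsPerfect)
    (h : ω ∉ ⋃ (j : ℕ) (_ : 1 ≤ j), B.ordersWith j) : ω.maxPaths.Infinite := by
  intro hfin
  obtain ⟨φ, hφ⟩ := hω
  refine h (Set.mem_iUnion₂.mpr ⟨ω.maxPaths.ncard, ?_, ?_, ?_⟩)
  · exact (Set.ncard_pos hfin).mpr (maxPaths_nonempty ω)
  · exact hfin.cast_ncard_eq.symm
  · rw [← EdgeOrder.image_maxPaths hφ, φ.injective.encard_image]
    exact hfin.cast_ncard_eq.symm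

end

end BratteliDiagram

/-! ### Telescoping over a finite linear order -/

section FiniteLinearOrder

variable {ι : Type*} [LinearOrder ι]

/-- A function on a finite linear order that is unchanged by passing to successors is constant. -/
theorem eq_of_forall_covBy_eq [Finite ι] {γ : Type*} {α : ι → γ} (h : ∀ e f, e ⋖ f → α e = α f)
    (e f : ι) : α e = α f := by
  have := Fintype.ofFinite ι
  have : LocallyFiniteOrder ι := Fintype.toLocallyFiniteOrder
  wlog hef : e ≤ f generalizing e f
  · exact (this f e (le_of_not_ge hef)).symm
  induction le_iff_reflTransGen_covBy.mp hef with
  | refl => rfl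
  | tail hab hbc ih => exact (ih (le_iff_reflTransGen_covBy.mpr hab)).trans (h _ _ hbc)

theorem sum_sub_telescope [Fintype ι] [Nonempty ι] {α β : ι → ℤ} {a b : ℤ}
    (h : ∀ e f, e ⋖ f → α e = β f) (ha : ∀ e, (∀ f, f ≤ e) → α e = a)
    (hb : ∀ e, (∀ f, e ≤ f) → β e = b) : ∑ e, (α e - β e) = a - b := by
  obtain ⟨k, hk⟩ : ∃ k, Fintype.card ι = k + 1 :=
    ⟨_, (Nat.succ_pred_eq_of_pos Fintype.card_pos).symm⟩
  let s : Fin (k + 1) ≃o ι := monoEquivOfFin ι hk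
  rw [Finset.sum_sub_distrib, ← s.toEquiv.sum_comp α, ← s.toEquiv.sum_comp β,
    Fin.sum_univ_castSucc, Fin.sum_univ_succ (fun i => β (s.toEquiv i))]
  have h1 : α (s.toEquiv (Fin.last k)) = a := ha _ fun f => by
    rw [← s.apply_symm_apply f]
    exact s.monotone (Fin.le_last _)
  have h2 : β (s.toEquiv 0) = b := hb _ fun f => by
    rw [← s.apply_symm_apply f]
    exact s.monotone (Fin.zero_le _)
  have h3 : ∀ i : Fin k, α (s.toEquiv i.castSucc) = β (s.toEquiv i.succ) := fun i =>
    h _ _ ((apply_covBy_apply_iff s).mpr (Fin.covBy_iff.mpr (by simp)))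
  rw [h1, h2, Finset.sum_congr rfl fun i _ => h3 i]
  ring

end FiniteLinearOrder

namespace BratteliDiagram

noncomputable section

variable {B : BratteliDiagram}

/-! ### The transition maps -/

instance {n : ℕ} (w : B.V (n + 1)) : Fintype (B.Incoming w) := Fintype.ofFinite _

-- Grouping incoming edges by source turns the matrix product into a sum over a linearly ordered
-- set, where telescoping applies.
open Classical in
theorem incidence_mulVec (n : ℕ) (x : B.V n → ℤ) (w : B.V (n + 1)) :
    (B.incidence n).mulVec x w = ∑ e : B.Incoming w, x (B.src e.1) := by
  rw [← Finset.sum_fiberwise Finset.univ (fun e : B.Incoming w => B.src e.1)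
    (fun e => x (B.src e.1))]
  refine Finset.sum_congr rfl fun v _ => ?_
  rw [Finset.sum_congr rfl (g := fun _ => x v)
    fun e he => congrArg x (Finset.mem_filter.mp he).2, Finset.sum_const, nsmul_eq_mul]
  congr 1
  change ((Nat.card {e : B.E n // B.rng e = w ∧ B.src e = v} : ℕ) : ℤ) = _
  rw [← Fintype.card_subtype, ← Nat.card_eq_fintype_card]
  exact congrArg _ (Nat.card_congr
    (Equiv.subtypeSubtypeEquivSubtypeInter (fun e : B.E n => B.rng e = w)
      (fun e => B.src e = v))).symm

theorem transition_self (n : ℕ) (x : B.V n → ℤ) : B.transition n n le_rfl x = x := by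
  unfold transition
  rw [Nat.leRecOn_self]
  rfl

theorem transition_succ {m n : ℕ} (h : m ≤ n) (h' : m ≤ n + 1) (x : B.V m → ℤ) :
    B.transition m (n + 1) h' x = (B.incidence n).mulVec (B.transition m n h x) := by
  unfold transition
  rw [Nat.leRecOn_succ h]
  rfl

instance : DirectedSystem (fun n : ℕ => B.V n → ℤ) (B.transition · · ·) where
  map_self := fun n x => transition_self n x
  map_map := by
    intro k j i hij hjk x
    induction k, hjk using Nat.le_induction with
    | base => exact transition_self _ _
    | succ k hjk ih => rw [transition_succ hjk, ih, ← transition_succ]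

theorem transition_nonneg {m n : ℕ} (h : m ≤ n) {x : B.V m → ℤ} (hx : 0 ≤ x) :
    0 ≤ B.transition m n h x := by
  induction n, h using Nat.le_induction with
  | base => rwa [transition_self]
  | succ n h ih =>
    intro w
    rw [transition_succ h, incidence_mulVec]
    exact Finset.sum_nonneg fun e _ => ih _

theorem FinPath.le {m n : ℕ} {v : B.V m} {w : B.V n} (p : B.FinPath v w) : m ≤ n := by
  induction p with
  | nil => exact le_rfl
  | snoc e p ih => omega

-- The entry counts the paths from `v` to `w`; the induction retains only the contribution of the
-- last edge of `p`.
open Classical in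
theorem FinPath.one_le_transition {m n : ℕ} {v : B.V m} {w : B.V n} (p : B.FinPath v w)
    (h : m ≤ n) : 1 ≤ B.transition m n h (Pi.single v 1) w := by
  induction p with
  | nil => rw [transition_self, Pi.single_eq_same]
  | snoc e p ih =>
    have hn := p.le
    rw [transition_succ hn, incidence_mulVec]
    refine (ih hn).trans (Finset.single_le_sum
      (f := fun e' : B.Incoming (B.rng e) => B.transition _ _ hn (Pi.single v 1) (B.src e'.1))
      (fun e' _ => transition_nonneg hn ?_ _) (Finset.mem_univ ⟨e, rfl⟩))
    exact Pi.single_nonneg.mpr zero_le_one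

open Classical in
theorem sum_le_transition {m n : ℕ} (h : m ≤ n) {x : B.V m → ℤ} (hx : 0 ≤ x) (w : B.V n)
    (hw : ∀ v : B.V m, Nonempty (B.FinPath v w)) : ∑ v, x v ≤ B.transition m n h x w := by
  have hsum : x = ∑ v, x v • (Pi.single v 1 : B.V m → ℤ) := by
    ext u
    simp [Finset.sum_apply, Pi.single_apply]
  conv_rhs => rw [hsum]
  rw [map_sum, Finset.sum_apply]
  refine Finset.sum_le_sum fun v _ => ?_
  obtain ⟨p⟩ := hw v
  rw [map_smul, Pi.smul_apply, smul_eq_mul]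
  exact le_mul_of_one_le_right (hx v) (p.one_le_transition h)

/-- The class in the dimension group of a vector of level `n`. -/
abbrev toDim (n : ℕ) : (B.V n → ℤ) →ₗ[ℤ] B.DimensionGroup :=
  Module.DirectLimit.of ℤ ℕ (fun n : ℕ => B.V n → ℤ) B.transition n

/-- The number of paths from the top vertex to the vertices of level `n`. -/
def heights (B : BratteliDiagram) (n : ℕ) : B.V n → ℤ := B.transition 0 n (Nat.zero_le n) 1

theorem one_le_heights (n : ℕ) (v : B.V n) : 1 ≤ B.heights n v := by
  induction n with
  | zero =>
    rw [heights, transition_self]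
    rfl
  | succ n ih =>
    rw [heights, transition_succ (Nat.zero_le n), incidence_mulVec]
    obtain ⟨e⟩ := EdgeOrder.nonempty_incoming v
    refine (ih (B.src e.1)).trans (Finset.single_le_sum
      (f := fun e' : B.Incoming v => B.heights n (B.src e'.1))
      (fun e' _ => zero_le_one.trans (ih _)) (Finset.mem_univ e))

/-- One element of the group, independent of `n`, is thus available for comparison with bounded
vectors at every level. -/
theorem toDim_heights (n : ℕ) : toDim n (B.heights n) = toDim 0 (1 : B.V 0 → ℤ) :=
  Module.DirectLimit.of_f

theorem transition_heights {m n : ℕ} (h : m ≤ n) :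
    B.transition m n h (B.heights m) = B.heights n :=
  DirectedSystem.map_map (f := fun i j (h : i ≤ j) => (B.transition i j h)) (Nat.zero_le m) h 1

namespace EdgeOrder

variable {ω : B.EdgeOrder}

/-- Maximal paths are separated by their vertices at large levels. -/
theorem exists_le_card_vertices (hinf : ω.maxPaths.Infinite) (K n₀ : ℕ) :
    ∃ n, n₀ ≤ n ∧ K ≤ Fintype.card (B.V n) := by
  classical
  obtain ⟨s, hs, hcard⟩ := hinf.exists_subset_card_eq K
  have hsep : ∀ p : B.PathSpace × B.PathSpace, ∃ n, p.1 ≠ p.2 → p.1.1 n ≠ p.2.1 n := by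
    intro p
    by_contra! h
    exact (h 0).1 (Subtype.ext (funext fun n => (h n).2))
  choose d hd using hsep
  obtain ⟨N, hN⟩ := ((s ×ˢ s).image d).bddAbove
  -- Beyond every index where two of the chosen paths first seen to differ do so, a common vertex
  -- would force equal maximal prefixes; `N + 1` makes the level exceed those indices strictly.
  refine ⟨max n₀ (N + 1), le_max_left _ _, ?_⟩
  rw [← hcard, ← Finset.card_univ]
  refine Finset.card_le_card_of_injOn (fun x => B.vertexAt x (max n₀ (N + 1)))
    (fun _ _ => Finset.mem_univ _) fun x hx y hy hxy => ?_
  by_contra hne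
  refine hd (x, y) hne (max_prefix_unique (ω := ω) (fun i _ => hs hx i) (fun i _ => hs hy i)
    hxy _ ?_)
  exact (Nat.lt_succ_of_le (hN (Finset.mem_coe.mpr (Finset.mem_image_of_mem d
    (Finset.mk_mem_product hx hy))))).trans_le (le_max_right _ _)

/-- At a level with `K` vertices each height is at least 1; a vertex reached from all of them
collects at least `K`. -/
theorem exists_le_heights (hB : B.IsSimple) (hinf : ω.maxPaths.Infinite) (K n₀ : ℕ) :
    ∃ n, n₀ ≤ n ∧ ∀ w, (K : ℤ) ≤ B.heights n w := by
  obtain ⟨n, hn, hK⟩ := exists_le_card_vertices hinf K n₀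
  obtain ⟨m, hnm, hm⟩ := hB n
  refine ⟨m, by omega, fun w => ?_⟩
  rw [← transition_heights hnm.le]
  refine le_trans ?_ (sum_le_transition hnm.le (fun v => zero_le_one.trans (one_le_heights n v)) w
    fun v => hm v w)
  calc (K : ℤ) ≤ Fintype.card (B.V n) := by exact_mod_cast hK
    _ = ∑ v : B.V n, (1 : ℤ) := by simp
    _ ≤ _ := Finset.sum_le_sum fun v _ => one_le_heights n v

/-! ### Coboundaries of the Vershik map in the dimension group -/

/-- `f` and `f ∘ φ⁻¹` depend only on the first `n` edges of a path. -/
def IsLevel (φ : B.PathSpace ≃ₜ B.PathSpace) (f : B.PathSpace → ℤ) (n : ℕ) : Prop :=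
  ∀ x y : B.PathSpace, (∀ i < n, y.1 i = x.1 i) → f y = f x ∧ f (φ.symm y) = f (φ.symm x)

theorem IsLevel.mono {φ : B.PathSpace ≃ₜ B.PathSpace} {f : B.PathSpace → ℤ} {m n : ℕ}
    (h : IsLevel φ f m) (hmn : m ≤ n) : IsLevel φ f n :=
  fun x y hxy => h x y fun i hi => hxy i (by omega)

theorem exists_isLevel (φ : B.PathSpace ≃ₜ B.PathSpace) (f : LocallyConstant B.PathSpace ℤ) :
    ∃ n, IsLevel φ f n := by
  obtain ⟨m, hm⟩ := exists_level f
  obtain ⟨n, hn⟩ := exists_level (f.comap ⟨φ.symm, φ.symm.continuous⟩)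
  exact ⟨max m n, fun x y h => ⟨hm x y fun i hi => h i (by omega),
    hn x y fun i hi => h i (by omega)⟩⟩

/-- The vector of level `n` that represents the difference of `f` and `f ∘ φ⁻¹`: away from the
maximal, respectively minimal, paths of length `n` the two functions contribute the same. -/
def coboundary (ω : B.EdgeOrder) (φ : B.PathSpace ≃ₜ B.PathSpace) (n : ℕ) :
    LocallyConstant B.PathSpace ℤ →+ (B.V n → ℤ) where
  toFun f v := f (ω.maxTo n v) - f (φ.symm (ω.minTo n v))
  map_zero' := by
    ext
    simp
  map_add' f g := by
    ext
    simp only [LocallyConstant.coe_add, Pi.add_apply]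
    ring

theorem coboundary_apply {φ : B.PathSpace ≃ₜ B.PathSpace} {n : ℕ}
    {f : LocallyConstant B.PathSpace ℤ} (v : B.V n) :
    ω.coboundary φ n f v = f (ω.maxTo n v) - f (φ.symm (ω.minTo n v)) := rfl

section Level

variable {φ : B.PathSpace ≃ₜ B.PathSpace} {n : ℕ} {f : B.PathSpace → ℤ}

theorem IsLevel.eq_maxTo (hf : IsLevel φ f n) {x : B.PathSpace}
    (hx : ∀ i < n, ω.IsMaxEdge (x.1 i)) : f (ω.maxTo n (B.vertexAt x n)) = f x :=
  (hf x _ (maxTo_prefix hx)).1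

theorem IsLevel.eq_minTo (hf : IsLevel φ f n) {x : B.PathSpace}
    (hx : ∀ i < n, ω.IsMinEdge (x.1 i)) :
    f (φ.symm (ω.minTo n (B.vertexAt x n))) = f (φ.symm x) :=
  (hf x _ (minTo_prefix hx)).2

theorem IsLevel.of_isSuccEdge (hφ : ∀ x ∉ ω.maxPaths, ω.IsVershikImage x (φ x))
    (hf : IsLevel φ f n) {e e' : B.E n} (h : ω.IsSuccEdge e e') :
    f (ω.maxTo n (B.src e)) = f (φ.symm (ω.minTo n (B.src e'))) := by
  obtain ⟨x, h1, h2, h3, h4⟩ := exists_vershik_pair hφ h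
  rw [← h2, ← h4, hf.eq_maxTo h1, hf.eq_minTo h3, φ.symm_apply_apply]

/-- The maximal path to `B.rng e` enters through `e`, so its first `n` edges form the top of the
tower at `B.src e`. -/
theorem IsLevel.of_isMaxEdge (hf : IsLevel φ f n) {e : B.E n} (he : ω.IsMaxEdge e) :
    f (ω.maxTo n (B.src e)) = f (ω.maxTo (n + 1) (B.rng e)) := by
  have hx := ω.isMaxEdge_maxTo (n + 1) (B.rng e)
  have hv := ω.vertexAt_maxTo (n + 1) (B.rng e)
  rw [vertexAt_succ] at hv
  rw [← hf.eq_maxTo fun i hi => hx i (by omega), vertexAt, (hx n (by omega)).eq he hv]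

theorem IsLevel.of_isMinEdge (hf : IsLevel φ f n) {e : B.E n} (he : ω.IsMinEdge e) :
    f (φ.symm (ω.minTo n (B.src e))) = f (φ.symm (ω.minTo (n + 1) (B.rng e))) := by
  have hx := ω.isMinEdge_minTo (n + 1) (B.rng e)
  have hv := ω.vertexAt_minTo (n + 1) (B.rng e)
  rw [vertexAt_succ] at hv
  rw [← hf.eq_minTo fun i hi => hx i (by omega), vertexAt,
    IsMaxEdge.eq (ω := ω.dual) (hx n (by omega)) he hv]

end Level

section Coboundary

variable {φ : B.PathSpace ≃ₜ B.PathSpace}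

/-- The tower of `w` stacks the towers of the sources of its incoming edges. Each top cancels the
next bottom, leaving the extreme top and bottom. -/
theorem incidence_coboundary (hφ : ∀ x ∉ ω.maxPaths, ω.IsVershikImage x (φ x)) {n : ℕ}
    {f : LocallyConstant B.PathSpace ℤ} (hf : IsLevel φ f n) :
    (B.incidence n).mulVec (ω.coboundary φ n f) = ω.coboundary φ (n + 1) f := by
  ext w
  rw [incidence_mulVec]
  let := ω n w
  refine sum_sub_telescope (ι := B.Incoming w) (fun e e' h => ?_) (fun e he => ?_) fun e he => ?_
  · exact hf.of_isSuccEdge hφ ((ω.isSuccEdge_iff e e').2 h)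
  · rw [hf.of_isMaxEdge ((ω.isMaxEdge_iff e).2 he), e.2]
  · rw [hf.of_isMinEdge ((ω.isMinEdge_iff e).2 he), e.2]

theorem transition_coboundary (hφ : ∀ x ∉ ω.maxPaths, ω.IsVershikImage x (φ x)) {m n : ℕ}
    (h : m ≤ n) {f : LocallyConstant B.PathSpace ℤ} (hf : IsLevel φ f m) :
    B.transition m n h (ω.coboundary φ m f) = ω.coboundary φ n f := by
  induction n, h using Nat.le_induction with
  | base => exact transition_self _ _
  | succ n h ih => rw [transition_succ h, ih, incidence_coboundary hφ (hf.mono h)]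

theorem toDim_coboundary_eq (hφ : ∀ x ∉ ω.maxPaths, ω.IsVershikImage x (φ x)) {m n : ℕ}
    {f : LocallyConstant B.PathSpace ℤ} (hm : IsLevel φ f m) (hn : IsLevel φ f n) :
    toDim m (ω.coboundary φ m f) = toDim n (ω.coboundary φ n f) := by
  wlog h : m ≤ n generalizing m n
  · exact (this hn hm (le_of_not_ge h)).symm
  rw [← transition_coboundary hφ h hm]
  exact Module.DirectLimit.of_f.symm

/-- The class in the dimension group of the difference of `f` and `f ∘ φ⁻¹`. -/
def coboundaryClass (hφ : ∀ x ∉ ω.maxPaths, ω.IsVershikImage x (φ x)) :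
    LocallyConstant B.PathSpace ℤ →+ B.DimensionGroup :=
  AddMonoidHom.mk' (fun f => toDim _ (ω.coboundary φ (exists_isLevel φ f).choose f)) fun f g => by
    have hf := (exists_isLevel φ f).choose_spec
    have hg := (exists_isLevel φ g).choose_spec
    have hfg := (exists_isLevel φ (f + g)).choose_spec
    -- The three classes were chosen at unrelated levels; additivity holds once they are moved to a
    -- common one.
    let N := max (exists_isLevel φ (f + g)).choose
      (max (exists_isLevel φ f).choose (exists_isLevel φ g).choose)
    rw [toDim_coboundary_eq hφ hf (hf.mono (n := N) (by omega)),
      toDim_coboundary_eq hφ hg (hg.mono (n := N) (by omega)),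
      toDim_coboundary_eq hφ hfg (hfg.mono (n := N) (by omega)), map_add, map_add]

theorem coboundaryClass_eq (hφ : ∀ x ∉ ω.maxPaths, ω.IsVershikImage x (φ x)) {n : ℕ}
    {f : LocallyConstant B.PathSpace ℤ} (hf : IsLevel φ f n) :
    coboundaryClass hφ f = toDim n (ω.coboundary φ n f) :=
  toDim_coboundary_eq hφ (exists_isLevel φ f).choose_spec hf

/-- With `C` bounding |f|, the coboundary is at most 2C entrywise. At a level of heights at least
`K`, `K` times it is below 2C times the heights, whose trace does not depend on `K`; let `K` grow.
-/
theorem trace_coboundaryClass_nonpos (hφ : ∀ x ∉ ω.maxPaths, ω.IsVershikImage x (φ x))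
    (hB : B.IsSimple) (hinf : ω.maxPaths.Infinite) {τ : B.DimensionGroup →+ ℝ} (hτ : B.IsTrace τ)
    (f : LocallyConstant B.PathSpace ℤ) : τ (coboundaryClass hφ f) ≤ 0 := by
  obtain ⟨C, hC⟩ : ∃ C : ℤ, ∀ x, |f x| ≤ C := by
    obtain ⟨C, hC⟩ := (f.range_finite.image abs).bddAbove
    exact ⟨C, fun x => hC ⟨f x, ⟨x, rfl⟩, rfl⟩⟩
  obtain ⟨n, hn⟩ := exists_isLevel φ f
  have hbound : ∀ K : ℕ, (K : ℝ) * τ (coboundaryClass hφ f) ≤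
      2 * C * τ (toDim 0 (1 : B.V 0 → ℤ)) := by
    intro K
    obtain ⟨m, hm, hK⟩ := exists_le_heights hB hinf K n
    rw [coboundaryClass_eq hφ (hn.mono hm), ← toDim_heights m]
    have hpos : 0 ≤ (2 * C) • B.heights m - (K : ℤ) • ω.coboundary φ m f := by
      intro w
      have h1 := abs_le.mp (hC (ω.maxTo m w))
      have h2 := abs_le.mp (hC (φ.symm (ω.minTo m w)))
      have h3 : ω.coboundary φ m f w ≤ 2 * C := by
        rw [coboundary_apply]
        linarith
      have h4 : (K : ℤ) * ω.coboundary φ m f w ≤ K * (2 * C) :=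
        mul_le_mul_of_nonneg_left h3 (Nat.cast_nonneg K)
      have h5 : (K : ℤ) * (2 * C) ≤ B.heights m w * (2 * C) :=
        mul_le_mul_of_nonneg_right (hK w) (by linarith)
      change 0 ≤ 2 * C * B.heights m w - K * ω.coboundary φ m f w
      linarith
    have h := hτ _ ⟨m, _, hpos, rfl⟩
    rw [map_sub, map_smul, map_smul, map_sub, map_zsmul, map_zsmul] at h
    simp only [zsmul_eq_mul] at h
    push_cast at h
    exact sub_nonneg.mp h
  by_contra! h
  obtain ⟨K, hK⟩ := exists_nat_gt (2 * C * τ (toDim 0 (1 : B.V 0 → ℤ)) / τ (coboundaryClass hφ f))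
  rw [div_lt_iff₀ h] at hK
  exact absurd (hbound K) (not_le.mpr hK)

theorem coboundaryClass_mem_infinitesimals (hφ : ∀ x ∉ ω.maxPaths, ω.IsVershikImage x (φ x))
    (hB : B.IsSimple) (hinf : ω.maxPaths.Infinite) (f : LocallyConstant B.PathSpace ℤ) :
    coboundaryClass hφ f ∈ B.infinitesimals := by
  intro τ hτ
  refine le_antisymm (trace_coboundaryClass_nonpos hφ hB hinf hτ f) ?_
  have := trace_coboundaryClass_nonpos hφ hB hinf hτ (-f)
  rw [map_neg, map_neg] at this
  linarith

/-- If the coboundary of `f` vanishes in the dimension group, then `f` is constant on the maximal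
paths. -/
theorem eq_of_coboundaryClass_eq_zero (hφ : ∀ x ∉ ω.maxPaths, ω.IsVershikImage x (φ x))
    (hB : B.IsSimple) {f : LocallyConstant B.PathSpace ℤ} (hf : coboundaryClass hφ f = 0)
    {x y : B.PathSpace} (hx : x ∈ ω.maxPaths) (hy : y ∈ ω.maxPaths) : f x = f y := by
  obtain ⟨l, hl⟩ := exists_isLevel φ f
  rw [coboundaryClass_eq hφ hl] at hf
  obtain ⟨n, hln, hn⟩ := Module.DirectLimit.of.zero_exact hf
  rw [transition_coboundary hφ hln hl] at hn
  -- A class that is zero is already represented by the zero vector at a finite level, and hence at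
  -- all later ones.
  have hzero : ∀ k ≥ n, ∀ v : B.V k, f (ω.maxTo k v) = f (φ.symm (ω.minTo k v)) := by
    intro k hk v
    have : ω.coboundary φ k f v = 0 := by
      rw [← transition_coboundary hφ hk (hl.mono hln), hn, map_zero]
      rfl
    rwa [coboundary_apply, sub_eq_zero] at this
  -- For consecutive edges a, b into one vertex, the top below a has the value of φ⁻¹(bottom below
  -- b), which by `hzero` is that of the top below b. All incoming edges thus agree with the maximal
  -- one, whose top is that of the vertex.
  have hstep : ∀ k ≥ n, ∀ e : B.E k, f (ω.maxTo k (B.src e)) = f (ω.maxTo (k + 1) (B.rng e)) := by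
    intro k hk e
    have hk' : IsLevel φ f k := hl.mono (hln.trans hk)
    obtain ⟨e', hr, he'⟩ := ω.exists_isMaxEdge (B.rng e)
    rw [← hr, ← hk'.of_isMaxEdge he']
    let := ω k (B.rng e)
    refine eq_of_forall_covBy_eq (ι := B.Incoming (B.rng e))
      (α := fun e => f (ω.maxTo k (B.src e.1))) (fun a b hab => ?_) ⟨e, rfl⟩ ⟨e', hr⟩
    rw [hzero k hk (B.src b.1)]
    exact hk'.of_isSuccEdge hφ ((ω.isSuccEdge_iff a b).2 hab)
  have hpath : ∀ (v : B.V n) {k : ℕ} (w : B.V k), B.FinPath v w →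
      f (ω.maxTo n v) = f (ω.maxTo k w) := by
    intro v k w p
    induction p with
    | nil => rfl
    | snoc e p ih => exact ih.trans (hstep _ p.le e)
  obtain ⟨m, -, hm⟩ := hB n
  obtain ⟨w⟩ := B.nonempty_vertices m
  have hconst : ∀ v : B.V n, f (ω.maxTo n v) = f (ω.maxTo m w) := fun v =>
    (hm v w).elim fun p => hpath v w p
  have hlev : IsLevel φ f n := hl.mono hln
  rw [← hlev.eq_maxTo fun i _ => hx i, ← hlev.eq_maxTo fun i _ => hy i, hconst, hconst]

end Coboundary

end EdgeOrder

/-! ### Separating maximal paths and conclusion -/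

/-- Infinitely many points of a set can be separated by clopen sets, each containing one of them. -/
theorem exists_separating_clopens {S : Set B.PathSpace} (hS : S.Infinite) :
    ∃ (x : ℕ → B.PathSpace) (U : ℕ → Set B.PathSpace), (∀ i, x i ∈ S) ∧ (∀ i, IsClopen (U i)) ∧
      ∀ i j, x i ∈ U j ↔ i = j := by
  have := hS.to_subtype
  obtain ⟨W, hne, hopen, hdisj⟩ := exists_seq_infinite_isOpen_pairwise_disjoint S
  choose x hx using fun i => (hne i).nonempty
  -- The disjoint sets `W i` are open only in `S`; cylinders whose traces on `S` lie in them are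
  -- clopen in the whole space, and only these traces need be disjoint.
  have hn : ∀ i, ∃ n, ∀ y : S, (∀ j < n, y.1.1 j = (x i).1.1 j) → y ∈ W i := by
    intro i
    obtain ⟨O, hO, hOW⟩ := mem_nhds_subtype S (x i) (W i) |>.mp ((hopen i).mem_nhds (hx i))
    obtain ⟨n, hn⟩ := exists_cylinder_subset hO
    exact ⟨n, fun y hy => hOW (hn hy)⟩
  choose n hn using hn
  refine ⟨fun i => (x i).1, fun i => {y | ∀ j < n i, y.1 j = (x i).1.1 j}, fun i => (x i).2,
    fun i => isClopen_cylinder _ _, fun i j => ⟨fun h => ?_, ?_⟩⟩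
  · by_contra hij
    exact Set.disjoint_left.mp (hdisj hij) (hx i) (hn j (x i) h)
  · rintro rfl
    exact fun _ _ => rfl

end

end BratteliDiagram

theorem theorem5p4 (B : BratteliDiagram) (hB : B.IsSimple) (ω : B.EdgeOrder)
    (hω : ω ∈ B.perfectStarOrders \ ⋃ (j : ℕ) (_ : 1 ≤ j), B.ordersWith j) :
    ∃ f : FreeAbelianGroup ℕ →+ B.infinitesimals, Function.Injective f := by
  classical
  have hperf : ω.IsPerfect := hω.1.1
  have hinf := BratteliDiagram.maxPaths_infinite hperf hω.2
  obtain ⟨φ, hφ⟩ := hperf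
  obtain ⟨x, U, hxS, hU, hxU⟩ := BratteliDiagram.exists_separating_clopens hinf
  let g : FreeAbelianGroup ℕ →+ LocallyConstant B.PathSpace ℤ :=
    -- The shift keeps `x 0` outside all sets used. It serves as a base point: only differences of
    -- values on X_max are controlled by the class.
    FreeAbelianGroup.lift fun i => LocallyConstant.charFn ℤ (hU (i + 1))
  have hg : ∀ (a : FreeAbelianGroup ℕ) (i : ℕ),
      g a (x (i + 1)) - g a (x 0) = FreeAbelianGroup.coeff i a := by
    intro a i
    have : ((LocallyConstant.evalAddMonoidHom (x (i + 1)) :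
        LocallyConstant B.PathSpace ℤ →+ ℤ) - LocallyConstant.evalAddMonoidHom (x 0)).comp g =
        FreeAbelianGroup.coeff i := by
      ext j
      simp [g, LocallyConstant.charFn, Set.indicator_apply, hxU, FreeAbelianGroup.coeff,
        Finsupp.single_apply, eq_comm]
    exact DFunLike.congr_fun this a
  let F : FreeAbelianGroup ℕ →+ B.infinitesimals :=
    ((BratteliDiagram.EdgeOrder.coboundaryClass hφ).comp g).codRestrict B.infinitesimals fun a =>
      BratteliDiagram.EdgeOrder.coboundaryClass_mem_infinitesimals hφ hB hinf (g a)
  refine ⟨F, (injective_iff_map_eq_zero F).mpr fun a ha => ?_⟩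
  have h0 : BratteliDiagram.EdgeOrder.coboundaryClass hφ (g a) = 0 := congrArg Subtype.val ha
  rw [← FreeAbelianGroup.support_eq_empty, Finset.eq_empty_iff_forall_notMem]
  -- The `i`-th coefficient is the difference of the values of `g a` at two maximal paths, hence
  -- zero.
  intro i
  rw [FreeAbelianGroup.notMem_support_iff, ← hg, sub_eq_zero]
  exact BratteliDiagram.EdgeOrder.eq_of_coboundaryClass_eq_zero hφ hB h0 (hxS _) (hxS _)
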